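/- Let $d\ge 2$, let $\Omega$ be a compact metric space with a Borel probability measure $\mu$, and let $(T_x)_{x\in\mathbf R^d}$ be a group action of $\mathbf R^d$ on $\Omega$ ($T_0=\mathrm{Id}$, $T_{x+y}=T_x\circ T_y$) such that $(x,\omega)\mapsto T_x\omega$ is measurable, each $T_x:\Omega\to\Omega$ is continuous, and each $T_x$ preserves $\mu$. For $u:\Omega\to\mathbf R$ put $D_iu(\omega)=\lim_{\delta\to0}\frac{u(T_{\delta e_i}\omega)-u(\omega)}{\delta}$ when the limit exists, and let $C^1(\Omega)$ be the set of continuous $u$ for which $D_1u,\dots,D_du$ exist at every point of $\Omega$ and are continuous on $\Omega$; write $D_\omega u=(D_1u,\dots,D_du)$. Let $L^2_{\rm pot}(\Omega)$ be the closure of $\{D_\omega u: u\in C^1(\Omega)\}$ in $L^2(\Omega,\mathbf R^d)$ and $L^2_{\rm sol}(\Omega)=L^2_{\rm pot}(\Omega)^{\perp}$; thus $\sigma\in L^2_{\rm sol}(\Omega)$ means that its stochastic divergence vanishes: $\int_\Omega\sigma\cdot D_\omega u\,d\mu=0$ for all $u\in C^1(\Omega)$. Let $L^2_{\rm sol,loc}(\mathbf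 R^d)$ be the closure of $\{\tau\in C_c^\infty(\mathbf R^d,\mathbf R^d):\operatorname{div}\tau\equiv0\}$ in $L^2_{\rm loc}(\mathbf R^d,\mathbf R^d)$. Theorem. If $\sigma\in L^2_{\rm sol}(\Omega)$, then for $\mu$-almost every $\omega$ the realization $x\mapsto\sigma(T_x\omega)$ belongs to $L^2_{\rm sol,loc}(\mathbf R^d)$. -/

import Mathlib

open MeasureTheory

noncomputable section

section StochasticSide

variable {d : ℕ} {Ω : Type*}

/-- The orbit of `ω` in the `i`-th coordinate direction, composed with `u`:
`δ ↦ u (T_{δ e_i} ω)`. -/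
def alongOrbit (T : EuclideanSpace ℝ (Fin d) → Ω → Ω) (i : Fin d) (u : Ω → ℝ) (ω : Ω) : ℝ → ℝ :=
  fun δ => u (T (δ • EuclideanSpace.single i (1 : ℝ)) ω)

/-- The stochastic derivative `D_i u (ω) = lim_{δ → 0} (u (T_{δ e_i} ω) - u ω) / δ`. -/
def stochDeriv (T : EuclideanSpace ℝ (Fin d) → Ω → Ω) (i : Fin d) (u : Ω → ℝ) (ω : Ω) : ℝ :=
  deriv (alongOrbit T i u ω) 0

/-- The stochastic gradient `D_ω u = (D_1 u, …, D_d u)`. -/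
def stochGrad (T : EuclideanSpace ℝ (Fin d) → Ω → Ω) (u : Ω → ℝ) (ω : Ω) :
    EuclideanSpace ℝ (Fin d) :=
  WithLp.toLp 2 (fun i => stochDeriv T i u ω)

/-- `u ∈ C¹(Ω)`: `u` is continuous, all the limits `D_i u (ω)` exist at every `ω`, and every
`D_i u` is continuous on `Ω`. -/
structure IsStochC1 [TopologicalSpace Ω] (T : EuclideanSpace ℝ (Fin d) → Ω → Ω)
    (u : Ω → ℝ) : Prop where
  continuous : Continuous u
  differentiable : ∀ (i : Fin d) (ω : Ω), DifferentiableAt ℝ (alongOrbit T i u ω) 0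
  continuous_deriv : ∀ i : Fin d, Continuous (stochDeriv T i u)

variable [TopologicalSpace Ω] [MeasurableSpace Ω]

/-- The set `{D_ω u : u ∈ C¹(Ω)}` in `L²(Ω, ℝ^d)`. -/
def stochGradients (μ : Measure Ω) (T : EuclideanSpace ℝ (Fin d) → Ω → Ω) :
    Set (Lp (EuclideanSpace ℝ (Fin d)) 2 μ) :=
  {g | ∃ u : Ω → ℝ, IsStochC1 T u ∧ g =ᵐ[μ] stochGrad T u}

/-- `L²_pot(Ω)`: the closure of `{D_ω u : u ∈ C¹(Ω)}` (which is a linear subspace) in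
`L²(Ω, ℝ^d)`. -/
def L2pot (μ : Measure Ω) (T : EuclideanSpace ℝ (Fin d) → Ω → Ω) :
    Submodule ℝ (Lp (EuclideanSpace ℝ (Fin d)) 2 μ) :=
  (Submodule.span ℝ (stochGradients μ T)).topologicalClosure

/-- `L²_sol(Ω)`: the orthogonal complement of `L²_pot(Ω)` in `L²(Ω, ℝ^d)`. -/
def L2sol (μ : Measure Ω) (T : EuclideanSpace ℝ (Fin d) → Ω → Ω) :
    Submodule ℝ (Lp (EuclideanSpace ℝ (Fin d)) 2 μ) :=
  (L2pot μ T)ᗮ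

end StochasticSide

section PhysicalSide

variable {d : ℕ}

/-- The divergence `∑ i, ∂_i τ_i` of a vector field on `ℝ^d`. -/
def divField (τ : EuclideanSpace ℝ (Fin d) → EuclideanSpace ℝ (Fin d))
    (x : EuclideanSpace ℝ (Fin d)) : ℝ :=
  ∑ i : Fin d, (fderiv ℝ τ x (EuclideanSpace.single i (1 : ℝ))) i

/-- `τ ∈ C_c^∞(ℝ^d, ℝ^d)` with `div τ = 0`. -/
structure IsSolTestField (τ : EuclideanSpace ℝ (Fin d) → EuclideanSpace ℝ (Fin d)) : Prop where
  smooth : ContDiff ℝ ((⊤ : ℕ∞) : WithTop ℕ∞) τ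
  compactSupport : HasCompactSupport τ
  div_eq_zero : ∀ x, divField τ x = 0

/-- `f ∈ L²_loc(ℝ^d, ℝ^d)`. -/
def MemL2Loc (f : EuclideanSpace ℝ (Fin d) → EuclideanSpace ℝ (Fin d)) : Prop :=
  ∀ K : Set (EuclideanSpace ℝ (Fin d)), IsCompact K → MemLp f 2 (volume.restrict K)

/-- `f ∈ L²_sol,loc(ℝ^d)`: `f` is in `L²_loc`, and it is in the closure of the smooth compactly
supported divergence-free fields for the topology of `L²_loc`, in which the sets
`{g | ‖f - g‖_{L²(K)} < ε}` (`K` compact, `ε > 0`) form a neighbourhood basis of `f`. -/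
def MemL2SolLoc (f : EuclideanSpace ℝ (Fin d) → EuclideanSpace ℝ (Fin d)) : Prop :=
  MemL2Loc f ∧
    ∀ K : Set (EuclideanSpace ℝ (Fin d)), IsCompact K → ∀ ε : ℝ, 0 < ε →
      ∃ τ : EuclideanSpace ℝ (Fin d) → EuclideanSpace ℝ (Fin d), IsSolTestField τ ∧
        eLpNorm (fun x => f x - τ x) 2 (volume.restrict K) < ENNReal.ofReal ε

end PhysicalSide

end

/-!
A solenoidal random field has weakly divergence-free realizations, and a weakly divergence-free
field on `ℝ^d` is a limit in `L²_loc` of compactly supported smooth solenoidal fields.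

*From `Ω` to `ℝ^d`.* For continuous `v` and a compactly supported `η` of class `C¹`, the orbit
average `u ω = ∫ v (T_t ω) η(-t) dt` is in `C¹(Ω)` and its gradient is the orbit average of `v`
with weight `Dη` (`isStochC1_orbitAverage`, `inner_stochGrad_orbitAverage`). Orthogonality of `σ`
to the gradient of `u`, Fubini's theorem and stationarity give
`∫ v(ω) (∫ Dη(t) σ(T_t ω) dt) dμ(ω) = 0` for all continuous `v`, so the inner integral vanishes
for almost every `ω` (`ae_integral_fderiv_apply_realization_eq_zero`). Only the translates of a
sequence of mollifiers are needed as `η`; by continuity, countably many translates suffice.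

*On `ℝ^d`.* Let `f` be a realization. Its mollifications are smooth, solenoidal, and converge to
`f` in `L²` on compact sets (`exists_forall_eLpNorm_sub_convolution_le`). It remains to cut off a
smooth solenoidal `g` without destroying solenoidality
(`exists_isSolTestField_eqOn_ball`). With `G x = ∫₀¹ t^(d-2) g(t x) dt`, which requires `d ≥ 2`,
one has `div G = 0` and `(d - 1) G + DG(x) x = g`, so that the row-wise divergence of the
antisymmetric matrix `G ⊗ x - x ⊗ G` is `g`. Multiplying the matrix by a cut-off `χ` before taking
the divergence gives the compactly supported solenoidal field `χ g + (Dχ x) G - (Dχ G) x`, equal to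
`g` where `χ = 1`.
-/

open Filter Topology Set
open scoped Convolution

/-! ### Smoothness of parametric integrals -/

section ParametricIntegral

open scoped ContDiff

variable {E V : Type} [NormedAddCommGroup E] [NormedSpace ℝ E] [FiniteDimensional ℝ E]
  [NormedAddCommGroup V] [NormedSpace ℝ V]

theorem hasFDerivAt_intervalIntegral_of_contDiff {F : E × ℝ → V} (hF : ContDiff ℝ 1 F)
    (a b : ℝ) (x : E) :
    HasFDerivAt (fun y => ∫ t in a..b, F (y, t))
      (∫ t in a..b, (fderiv ℝ F (x, t)).comp (ContinuousLinearMap.inl ℝ E ℝ)) x := by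
  have hcont : Continuous fun p : E × ℝ =>
      (fderiv ℝ F p).comp (ContinuousLinearMap.inl ℝ E ℝ) :=
    (hF.continuous_fderiv one_ne_zero).clm_comp continuous_const
  have hK : IsCompact (Metric.closedBall x 1 ×ˢ uIcc a b) :=
    (isCompact_closedBall x 1).prod isCompact_uIcc
  obtain ⟨C, hC⟩ := hK.exists_bound_of_continuousOn hcont.continuousOn
  refine intervalIntegral.hasFDerivAt_integral_of_dominated_of_fderiv_le
    (F' := fun y t => (fderiv ℝ F (y, t)).comp (ContinuousLinearMap.inl ℝ E ℝ))
    (bound := fun _ => C) (Metric.closedBall_mem_nhds x one_pos) ?_ ?_ ?_ ?_ ?_ ?_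
  · exact Eventually.of_forall fun y =>
      (hF.continuous.comp (by fun_prop : Continuous fun t : ℝ => (y, t))).aestronglyMeasurable
  · exact (hF.continuous.comp (by fun_prop : Continuous fun t : ℝ => (x, t))).intervalIntegrable _ _
  · exact (hcont.comp (by fun_prop : Continuous fun t : ℝ => (x, t))).aestronglyMeasurable
  · exact Eventually.of_forall fun t ht y hy => hC (y, t) ⟨hy, uIoc_subset_uIcc ht⟩
  · exact intervalIntegrable_const
  · refine Eventually.of_forall fun t _ y _ => ?_
    have h1 : HasFDerivAt F (fderiv ℝ F (y, t)) (y, t) :=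
      (hF.differentiable one_ne_zero _).hasFDerivAt
    have h2 : HasFDerivAt (fun z : E => (z, t)) (ContinuousLinearMap.inl ℝ E ℝ) y :=
      hasFDerivAt_prodMk_left y t
    exact h1.comp y h2

/-- Induction on the order of differentiability: the derivative is again a parametric integral,
with values in `E →L[ℝ] V`. Both spaces live in `Type` so that the induction can change `V`. -/
theorem contDiff_intervalIntegral {F : E × ℝ → V} (hF : ContDiff ℝ ∞ F) (a b : ℝ) :
    ContDiff ℝ ∞ fun x => ∫ t in a..b, F (x, t) := by
  rw [contDiff_infty]
  intro n
  induction n generalizing V with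
  | zero =>
    refine contDiff_zero.2 (continuous_iff_continuousAt.2 fun x => ?_)
    exact (hasFDerivAt_intervalIntegral_of_contDiff (hF.of_le (by simp)) a b x).continuousAt
  | succ n ih =>
    have h := hasFDerivAt_intervalIntegral_of_contDiff
      (hF.of_le (by simp) : ContDiff ℝ 1 F) a b
    push_cast
    refine contDiff_succ_iff_fderiv.2 ⟨fun x => (h x).differentiableAt, by simp, ?_⟩
    rw [show fderiv ℝ (fun x => ∫ t in a..b, F (x, t)) = _ from funext fun x => (h x).fderiv]
    refine ih (F := fun p => (fderiv ℝ F p).comp (ContinuousLinearMap.inl ℝ E ℝ)) ?_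
    exact (hF.fderiv_right (by simp)).clm_comp contDiff_const

end ParametricIntegral

/-! ### Cutting off smooth solenoidal fields -/

section SolenoidalFields

open scoped ContDiff

variable {d : ℕ}

/-- The trace of an endomorphism of `ℝ^d`, as a continuous linear form. The divergence of a field
is the trace of its derivative. -/
noncomputable def euclideanTrace (d : ℕ) :
    (EuclideanSpace ℝ (Fin d) →L[ℝ] EuclideanSpace ℝ (Fin d)) →L[ℝ] ℝ :=
  ∑ i : Fin d, (EuclideanSpace.proj i).comp
    (ContinuousLinearMap.apply ℝ (EuclideanSpace ℝ (Fin d)) (EuclideanSpace.single i (1 : ℝ)))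

theorem euclideanTrace_apply (A : EuclideanSpace ℝ (Fin d) →L[ℝ] EuclideanSpace ℝ (Fin d)) :
    euclideanTrace d A = ∑ i, A (EuclideanSpace.single i (1 : ℝ)) i := by
  simp [euclideanTrace]

theorem divField_eq_euclideanTrace
    (τ : EuclideanSpace ℝ (Fin d) → EuclideanSpace ℝ (Fin d)) (x : EuclideanSpace ℝ (Fin d)) :
    divField τ x = euclideanTrace d (fderiv ℝ τ x) :=
  (euclideanTrace_apply _).symm

theorem sum_smul_apply_single {V : Type*} [NormedAddCommGroup V] [NormedSpace ℝ V]
    (c : EuclideanSpace ℝ (Fin d) →L[ℝ] V) (v : EuclideanSpace ℝ (Fin d)) :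
    ∑ i, v i • c (EuclideanSpace.single i (1 : ℝ)) = c v := by
  conv_rhs => rw [← (EuclideanSpace.basisFun (Fin d) ℝ).sum_repr v]
  simp [map_sum]

theorem euclideanTrace_smulRight (c : EuclideanSpace ℝ (Fin d) →L[ℝ] ℝ)
    (v : EuclideanSpace ℝ (Fin d)) : euclideanTrace d (c.smulRight v) = c v := by
  rw [euclideanTrace_apply, ← sum_smul_apply_single c v]
  simp [mul_comm]

theorem euclideanTrace_id :
    euclideanTrace d (ContinuousLinearMap.id ℝ (EuclideanSpace ℝ (Fin d))) = d := by
  simp [euclideanTrace_apply]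

/-- The weighted radial average `G x = ∫₀¹ t^(d-2) g (t x) dt` of a field `g`. The bivector field
`G ∧ x` is the potential of `g` produced by the Poincaré lemma when `div g = 0`. -/
noncomputable def radialAverage (g : EuclideanSpace ℝ (Fin d) → EuclideanSpace ℝ (Fin d))
    (x : EuclideanSpace ℝ (Fin d)) : EuclideanSpace ℝ (Fin d) :=
  ∫ t in (0 : ℝ)..1, t ^ (d - 2) • g (t • x)

variable {g : EuclideanSpace ℝ (Fin d) → EuclideanSpace ℝ (Fin d)}

theorem contDiff_radialAverage (hg : ContDiff ℝ ∞ g) : ContDiff ℝ ∞ (radialAverage g) :=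
  contDiff_intervalIntegral
    (F := fun p : EuclideanSpace ℝ (Fin d) × ℝ => p.2 ^ (d - 2) • g (p.2 • p.1))
    (by fun_prop) 0 1

theorem hasFDerivAt_radialAverage (hd : 2 ≤ d) (hg : ContDiff ℝ ∞ g)
    (x : EuclideanSpace ℝ (Fin d)) :
    HasFDerivAt (radialAverage g) (∫ t in (0 : ℝ)..1, t ^ (d - 1) • fderiv ℝ g (t • x)) x := by
  have hF : ContDiff ℝ ∞
      (fun p : EuclideanSpace ℝ (Fin d) × ℝ => p.2 ^ (d - 2) • g (p.2 • p.1)) := by fun_prop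
  refine (hasFDerivAt_intervalIntegral_of_contDiff (hF.of_le (by simp)) 0 1 x).congr_fderiv ?_
  refine intervalIntegral.integral_congr fun t _ => ?_
  have h1 := ((hF.differentiable (by simp) (x, t)).hasFDerivAt).comp x
    (hasFDerivAt_prodMk_left (𝕜 := ℝ) x t)
  have h2 : HasFDerivAt (fun y => t ^ (d - 2) • g (t • y))
      (t ^ (d - 1) • fderiv ℝ g (t • x)) x := by
    have h3 : HasFDerivAt (fun y : EuclideanSpace ℝ (Fin d) => t • y)
        (t • ContinuousLinearMap.id ℝ (EuclideanSpace ℝ (Fin d))) x :=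
      (hasFDerivAt_id x).const_smul t
    have h4 := (((hg.differentiable (by simp) (t • x)).hasFDerivAt).comp x h3).const_smul
      (t ^ (d - 2))
    refine h4.congr_fderiv ?_
    rw [ContinuousLinearMap.comp_smul, ContinuousLinearMap.comp_id, smul_smul, ← pow_succ]
    congr 2
    omega
  exact h1.unique h2

/-- Radial averaging preserves solenoidality, since `div G x = ∫₀¹ t^(d-1) (div g) (t x) dt`. -/
theorem divField_radialAverage (hd : 2 ≤ d) (hg : ContDiff ℝ ∞ g)
    (hdiv : ∀ x, divField g x = 0) (x : EuclideanSpace ℝ (Fin d)) :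
    divField (radialAverage g) x = 0 := by
  have hc := hg.continuous_fderiv (by simp)
  rw [divField_eq_euclideanTrace, (hasFDerivAt_radialAverage hd hg x).fderiv,
    ← ContinuousLinearMap.intervalIntegral_comp_comm]
  · simp [← divField_eq_euclideanTrace, hdiv]
  · exact Continuous.intervalIntegrable (by fun_prop) _ _

/-- The homotopy identity `(d - 1) G + DG(x) x = g`, obtained by integrating
`d/dt (t^(d-1) g (t x))` over `[0, 1]`. -/
theorem radialAverage_homotopy (hd : 2 ≤ d) (hg : ContDiff ℝ ∞ g)
    (x : EuclideanSpace ℝ (Fin d)) :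
    ((d : ℝ) - 1) • radialAverage g x + fderiv ℝ (radialAverage g) x x = g x := by
  have hc := hg.continuous_fderiv (by simp)
  have hgc := hg.continuous
  rw [(hasFDerivAt_radialAverage hd hg x).fderiv,
    ContinuousLinearMap.intervalIntegral_apply
      (Continuous.intervalIntegrable (by fun_prop) _ _), radialAverage,
    ← intervalIntegral.integral_smul, ← intervalIntegral.integral_add
      (Continuous.intervalIntegrable (by fun_prop) _ _)
      (Continuous.intervalIntegrable (by fun_prop) _ _)]
  have hderiv : ∀ t : ℝ, HasDerivAt (fun s : ℝ => s ^ (d - 1) • g (s • x))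
      (((d : ℝ) - 1) • t ^ (d - 2) • g (t • x) + (t ^ (d - 1) • fderiv ℝ g (t • x)) x) t := by
    intro t
    have h1 : HasDerivAt (fun s : ℝ => s • x) x t := by
      simpa using (hasDerivAt_id t).smul_const x
    have h2 : HasDerivAt (fun s : ℝ => g (s • x)) (fderiv ℝ g (t • x) x) t :=
      ((hg.differentiable (by simp) (t • x)).hasFDerivAt).comp_hasDerivAt t h1
    have h3 := (hasDerivAt_pow (d - 1) t).smul h2
    refine h3.congr_deriv ?_
    have e1 : d - 1 - 1 = d - 2 := by omega
    have e2 : ((d - 1 : ℕ) : ℝ) = (d : ℝ) - 1 := by rw [Nat.cast_sub (by omega)]; simp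
    rw [e1, e2, smul_smul, add_comm]
    rfl
  rw [intervalIntegral.integral_eq_sub_of_hasDerivAt (fun t _ => hderiv t)
    (Continuous.intervalIntegrable (by fun_prop) _ _)]
  have : d - 1 ≠ 0 := by omega
  simp [this]

/-- A smooth solenoidal field can be cut off outside a ball without losing solenoidality: apply
the cut-off `χ` to the potential `G ∧ x` instead of to `g` itself, `G` being the radial average
of `g`. The row-wise divergence of `χ (G ∧ x)` is `χ g + (Dχ x) G - (Dχ G) x`. -/
theorem exists_isSolTestField_eqOn_ball (hd : 2 ≤ d) (hg : ContDiff ℝ ∞ g)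
    (hdiv : ∀ x, divField g x = 0) (R : ℝ) :
    ∃ τ : EuclideanSpace ℝ (Fin d) → EuclideanSpace ℝ (Fin d),
      IsSolTestField τ ∧ EqOn τ g (Metric.ball 0 R) := by
  set G := radialAverage g with hG
  have hGs : ContDiff ℝ ∞ G := contDiff_radialAverage hg
  let χ : ContDiffBump (0 : EuclideanSpace ℝ (Fin d)) :=
    ⟨|R| + 1, |R| + 2, by positivity, by linarith⟩
  have hχ : ContDiff ℝ ∞ χ := χ.contDiff
  have hDχ : ContDiff ℝ ∞ (fderiv ℝ χ) := hχ.fderiv_right (by simp)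
  refine ⟨fun x => χ x • g x + fderiv ℝ χ x x • G x - fderiv ℝ χ x (G x) • x, ⟨?_, ?_, ?_⟩, ?_⟩
  · fun_prop
  · have h1 : HasCompactSupport χ := χ.hasCompactSupport
    have h2 : HasCompactSupport (fderiv ℝ χ) := h1.fderiv ℝ
    refine HasCompactSupport.intro (h1.isCompact.union h2.isCompact) fun x hx => ?_
    simp only [mem_union, not_or] at hx
    simp [image_eq_zero_of_notMem_tsupport hx.1, image_eq_zero_of_notMem_tsupport hx.2]
  · intro x
    have dχ := (hχ.differentiable (by simp) x).hasFDerivAt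
    have dDχ := (hDχ.differentiable (by simp) x).hasFDerivAt
    have dg := (hg.differentiable (by simp) x).hasFDerivAt
    have dG := (hGs.differentiable (by simp) x).hasFDerivAt
    have did := hasFDerivAt_id (𝕜 := ℝ) x
    have h := ((dχ.smul dg).add ((dDχ.clm_apply did).smul dG)).sub ((dDχ.clm_apply dG).smul did)
    have hsymm := (hχ.contDiffAt (x := x)).isSymmSndFDerivAt
      (by simpa using show ((2 : ℕ∞) : WithTop ℕ∞) ≤ ∞ from WithTop.coe_le_coe.2 le_top) x (G x)
    have hhom := congrArg (fderiv ℝ χ x) (radialAverage_homotopy hd hg x)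
    have h1 := hdiv x
    have h2 := divField_radialAverage hd hg hdiv x
    rw [divField_eq_euclideanTrace] at h1 h2 ⊢
    rw [← hG] at hhom h2
    refine (congrArg (euclideanTrace d) h.fderiv).trans ?_
    simp only [map_add, map_sub, map_smul, euclideanTrace_smulRight, h1, h2, euclideanTrace_id]
    -- What remains is `Dχ (g - (d - 1) G - DG x) + D²χ (G, x) - D²χ (x, G)`.
    simp at hhom hsymm ⊢
    rw [← hhom, hsymm]
    ring
  · intro x hx
    have hev : χ =ᶠ[𝓝 x] fun _ => (1 : ℝ) := by
      have hx' : ‖x‖ < |R| + 1 := by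
        have := le_abs_self R
        have h' : ‖x‖ < R := by simpa using hx
        linarith
      filter_upwards [Metric.isOpen_ball.mem_nhds
        (show x ∈ Metric.ball 0 (|R| + 1) by simpa using hx')]
        with y hy
      exact χ.one_of_mem_closedBall (Metric.ball_subset_closedBall hy)
    have h0 : fderiv ℝ χ x = 0 := by rw [hev.fderiv_eq]; simp
    simp [h0, hev.eq_of_nhds]

end SolenoidalFields

/-! ### Mollification in `L²` -/

section Mollification

open scoped ENNReal

variable {E V : Type*} [NormedAddCommGroup E] [NormedSpace ℝ E] [FiniteDimensional ℝ E]
  [MeasurableSpace E] [BorelSpace E] [NormedAddCommGroup V]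
  {m : Measure E} [m.IsAddHaarMeasure]

/-- Translations act continuously on `L²`. -/
theorem exists_forall_eLpNorm_translate_sub_le {f : E → V} (hf : MemLp f 2 m)
    {ε : ℝ≥0∞} (hε : 0 < ε) :
    ∃ δ > 0, ∀ y : E, ‖y‖ < δ → eLpNorm (fun x => f (x - y) - f x) 2 m ≤ ε := by
  have : Fact ((2 : ℝ≥0∞) ≠ ⊤) := ⟨by norm_num⟩
  have hcont : Continuous fun y : E => (DomAddAct.mk (-y)) +ᵥ hf.toLp f := by
    have h1 : Continuous fun y : E => DomAddAct.mk (-y) :=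
      DomAddAct.continuous_mk.comp continuous_neg
    exact h1.vadd continuous_const
  have h0 : ∀ᶠ y : E in 𝓝 0, edist ((DomAddAct.mk (-y)) +ᵥ hf.toLp f)
      ((DomAddAct.mk (-(0 : E))) +ᵥ hf.toLp f) < ε :=
    (hcont.tendsto 0).eventually (Metric.eball_mem_nhds _ hε)
  obtain ⟨δ, hδ, hball⟩ := Metric.eventually_nhds_iff.1 h0
  refine ⟨δ, hδ, fun y hy => ?_⟩
  have h2 := (hball (by simpa using hy)).le
  rw [DomAddAct.mk_vadd_toLp, DomAddAct.mk_vadd_toLp, Lp.edist_toLp_toLp] at h2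
  refine le_of_eq_of_le (congrArg (fun h => eLpNorm h 2 m) ?_) h2
  ext x
  simp [sub_eq_neg_add]

variable [NormedSpace ℝ V]

/-- Jensen's inequality for the square of the norm. -/
theorem enorm_integral_sq_le_lintegral {α : Type*} [MeasurableSpace α] {ν : Measure α}
    [IsProbabilityMeasure ν] {h : α → V} (hh : AEStronglyMeasurable h ν) :
    ‖∫ y, h y ∂ν‖ₑ ^ 2 ≤ ∫⁻ y, ‖h y‖ₑ ^ 2 ∂ν := by
  have h1 : ‖∫ y, h y ∂ν‖ₑ ≤ eLpNorm h 2 ν := by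
    refine (enorm_integral_le_lintegral_enorm h).trans ?_
    rw [← eLpNorm_one_eq_lintegral_enorm]
    exact eLpNorm_le_eLpNorm_of_exponent_le (by norm_num) hh
  have h2 : eLpNorm h 2 ν ^ 2 = ∫⁻ y, ‖h y‖ₑ ^ 2 ∂ν := by
    have := eLpNorm_nnreal_pow_eq_lintegral (μ := ν) (f := h) (p := 2) (by norm_num)
    simpa using this
  rw [← h2]
  gcongr

variable [CompleteSpace V]

/-- Mollification converges in `L²`: the error `f - φ ⋆ f` is an average, over shifts `y` of size
less than the radius of `φ`, of the translation errors `f - f (· - y)`. -/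
theorem exists_forall_eLpNorm_sub_convolution_le {f : E → V} (hf : MemLp f 2 m)
    {ε : ℝ≥0∞} (hε : 0 < ε) :
    ∃ δ > 0, ∀ φ : ContDiffBump (0 : E), φ.rOut < δ →
      eLpNorm (fun x => f x - (φ.normed m ⋆[ContinuousLinearMap.lsmul ℝ ℝ, m] f) x) 2 m ≤ ε := by
  obtain ⟨δ, hδ, hT⟩ := exists_forall_eLpNorm_translate_sub_le hf hε
  refine ⟨δ, hδ, fun φ hφ => ?_⟩
  -- The mollifier as the density of a probability measure `ν` on the space of shifts.
  set w : E → NNReal := fun y => (φ.normed m y).toNNReal with hw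
  have hwm : Measurable w := φ.continuous_normed.measurable.real_toNNReal
  have hwc : ∀ y, (w y : ℝ) = φ.normed m y := fun y => Real.coe_toNNReal _ (φ.nonneg_normed y)
  set ν : Measure E := m.withDensity fun y => (w y : ℝ≥0∞) with hν
  have hνprob : IsProbabilityMeasure ν := by
    refine ⟨?_⟩
    rw [hν, withDensity_apply _ MeasurableSet.univ, Measure.restrict_univ]
    have := ofReal_integral_eq_lintegral_ofReal (φ.integrable_normed (μ := m))
      (Eventually.of_forall φ.nonneg_normed)
    rw [φ.integral_normed, ENNReal.ofReal_one] at this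
    exact this.symm
  have hac : ν ≪ m := withDensity_absolutelyContinuous _ _
  have hsq : ∀ h : E → V, eLpNorm h 2 m ^ 2 = ∫⁻ y, ‖h y‖ₑ ^ 2 ∂m := fun h => by
    simpa using eLpNorm_nnreal_pow_eq_lintegral (μ := m) (f := h) (p := 2) (by norm_num)
  have hfm := hf.aestronglyMeasurable
  have hshift : AEStronglyMeasurable (fun p : E × E => f (p.1 - p.2)) (m.prod m) :=
    hfm.comp_quasiMeasurePreserving (quasiMeasurePreserving_sub_of_right_invariant m m)
  have hdiff : AEStronglyMeasurable (fun p : E × E => f (p.1 - p.2) - f p.1) (m.prod m) :=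
    hshift.sub hfm.comp_fst
  have hloc : LocallyIntegrable f m := hf.locallyIntegrable (by norm_num)
  have hpt : ∀ x, ‖f x - (φ.normed m ⋆[ContinuousLinearMap.lsmul ℝ ℝ, m] f) x‖ₑ ^ 2
      ≤ ∫⁻ y, ‖f (x - y) - f x‖ₑ ^ 2 ∂ν := by
    intro x
    have hex : ConvolutionExistsAt (φ.normed m) f x (ContinuousLinearMap.lsmul ℝ ℝ) m :=
      φ.hasCompactSupport_normed.convolutionExists_left _ φ.continuous_normed hloc x
    have e1 : (φ.normed m ⋆[ContinuousLinearMap.lsmul ℝ ℝ, m] f) x - f x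
        = ∫ y, (f (x - y) - f x) ∂ν := by
      rw [hν, integral_withDensity_eq_integral_smul hwm]
      simp only [smul_sub, NNReal.smul_def, hwc]
      rw [integral_sub (f := fun y => φ.normed m y • f (x - y)) hex.integrable
        (φ.integrable_normed.smul_const _), integral_smul_const,
        φ.integral_normed, one_smul]
      rfl
    rw [enorm_sub_rev, e1]
    refine enorm_integral_sq_le_lintegral (AEStronglyMeasurable.mono_ac hac ?_)
    exact (hfm.comp_quasiMeasurePreserving
      (quasiMeasurePreserving_sub_left_of_right_invariant m x)).sub aestronglyMeasurable_const
  have hmain : eLpNorm (fun x => f x - (φ.normed m ⋆[ContinuousLinearMap.lsmul ℝ ℝ, m] f) x) 2 m ^ 2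
      ≤ ε ^ 2 := by
    rw [hsq]
    calc _ ≤ ∫⁻ x, ∫⁻ y, ‖f (x - y) - f x‖ₑ ^ 2 ∂ν ∂m := lintegral_mono hpt
      _ = ∫⁻ y, ∫⁻ x, ‖f (x - y) - f x‖ₑ ^ 2 ∂m ∂ν := by
          refine lintegral_lintegral_swap ?_
          exact ((hdiff.mono_ac (Measure.AbsolutelyContinuous.rfl.prod hac)).enorm.pow_const 2)
      _ = ∫⁻ y, w y * ∫⁻ x, ‖f (x - y) - f x‖ₑ ^ 2 ∂m ∂m := by
          rw [hν, lintegral_withDensity_eq_lintegral_mul₀ (by fun_prop)]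
          · rfl
          · exact (hdiff.enorm.pow_const 2).lintegral_prod_left'
      _ ≤ ∫⁻ y, w y * ε ^ 2 ∂m := by
          refine lintegral_mono fun y => ?_
          by_cases hy : y ∈ Metric.ball (0 : E) φ.rOut
          · rw [← hsq]
            gcongr
            exact hT y ((by simpa using hy : ‖y‖ < φ.rOut).trans hφ)
          · have : φ.normed m y = 0 := by
              rw [← φ.support_normed_eq (μ := m)] at hy
              exact Function.notMem_support.1 hy
            simp [hw, this]
      _ = ε ^ 2 := by
          have h1 := measure_univ (μ := ν)
          rw [hν, withDensity_apply _ MeasurableSet.univ, Measure.restrict_univ] at h1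
          rw [lintegral_mul_const _ (by fun_prop), h1, one_mul]
  exact (ENNReal.pow_le_pow_left_iff two_ne_zero).1 hmain

end Mollification

/-! ### Approximation of weakly solenoidal fields -/

section Criterion

open scoped ContDiff

variable {d : ℕ} {f : EuclideanSpace ℝ (Fin d) → EuclideanSpace ℝ (Fin d)}

theorem MemL2Loc.locallyIntegrable (hf : MemL2Loc f) : LocallyIntegrable f volume := by
  refine locallyIntegrable_iff.2 fun K hK => ?_
  have : IsFiniteMeasure (volume.restrict K) := ⟨by simpa using hK.measure_lt_top⟩
  exact (hf K hK).integrable (by norm_num)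

/-- The derivative falls on the mollifier: `div (ρ ⋆ f) x` is the distributional divergence of `f`
tested against `ρ (x - ·)`. -/
theorem divField_convolution {ρ : EuclideanSpace ℝ (Fin d) → ℝ} (hρ : ContDiff ℝ ∞ ρ)
    (hρc : HasCompactSupport ρ) (hf : LocallyIntegrable f volume) (x : EuclideanSpace ℝ (Fin d)) :
    divField (ρ ⋆[ContinuousLinearMap.lsmul ℝ ℝ, volume] f) x
      = ∫ t, fderiv ℝ ρ (x - t) (f t) := by
  have h := hρc.hasFDerivAt_convolution_left (ContinuousLinearMap.lsmul ℝ ℝ)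
    (hρ.of_le (by simp)) hf x
  have hint := ((hρc.fderiv ℝ).convolutionExists_left
    ((ContinuousLinearMap.lsmul ℝ ℝ : ℝ →L[ℝ] _ →L[ℝ] EuclideanSpace ℝ (Fin d)).precompL
      (EuclideanSpace ℝ (Fin d))) (hρ.continuous_fderiv (by simp)) hf x).integrable_swap
  rw [divField_eq_euclideanTrace, h.fderiv, convolution_eq_swap,
    ← ContinuousLinearMap.integral_comp_comm _ hint]
  exact integral_congr_ae (Eventually.of_forall fun t =>
    euclideanTrace_smulRight (fderiv ℝ ρ (x - t)) (f t))

/-- A locally square integrable field whose mollifications are solenoidal is a limit of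
compactly supported smooth solenoidal fields: near a given compact set, the mollifications
approximate it, and each of them coincides there with a compactly supported solenoidal field. -/
theorem memL2SolLoc_of_forall_integral_fderiv_eq_zero (hd : 2 ≤ d) (hf : MemL2Loc f)
    {φ : ℕ → ContDiffBump (0 : EuclideanSpace ℝ (Fin d))}
    (hφ : Tendsto (fun n => (φ n).rOut) atTop (𝓝 0))
    (hdiv : ∀ n x, ∫ t, fderiv ℝ ((φ n).normed volume) (x - t) (f t) = 0) :
    MemL2SolLoc f := by
  refine ⟨hf, fun K hK ε hε => ?_⟩
  obtain ⟨R, hR⟩ := hK.isBounded.subset_ball (0 : EuclideanSpace ℝ (Fin d))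
  -- Mollifying at scale less than `1`, only the values of `f` at distance less than `1` from `K`
  -- matter on `K`, so `f` may be truncated to a field in `L²`.
  set F := (Metric.ball (0 : EuclideanSpace ℝ (Fin d)) (R + 1)).indicator f with hF
  have hFmem : MemLp F 2 volume := by
    rw [hF, memLp_indicator_iff_restrict measurableSet_ball]
    exact (hf _ (isCompact_closedBall 0 (R + 1))).mono_measure
      (Measure.restrict_mono Metric.ball_subset_closedBall le_rfl)
  obtain ⟨δ, hδ, hmol⟩ := exists_forall_eLpNorm_sub_convolution_le hFmem
    (ε := ENNReal.ofReal (ε / 2)) (by simpa using hε)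
  obtain ⟨n, hn⟩ := (hφ.eventually (gt_mem_nhds (lt_min hδ one_pos))).exists
  set ρ := (φ n).normed volume with hρ
  have hloc := hf.locallyIntegrable
  have hρs : ContDiff ℝ ∞ ρ := (φ n).contDiff_normed
  have hρc : HasCompactSupport ρ := (φ n).hasCompactSupport_normed
  obtain ⟨τ, hτ, hτg⟩ := exists_isSolTestField_eqOn_ball hd
    (hρc.contDiff_convolution_left (ContinuousLinearMap.lsmul ℝ ℝ) hρs hloc)
    (fun x => (divField_convolution hρs hρc hloc x).trans (hdiv n x)) R
  refine ⟨τ, hτ, ?_⟩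
  have heq : ∀ x ∈ K, f x - τ x
      = F x - (ρ ⋆[ContinuousLinearMap.lsmul ℝ ℝ, volume] F) x := by
    intro x hx
    have hxR : ‖x‖ < R := by simpa using hR hx
    rw [hτg (hR hx), hF, indicator_of_mem (by simpa using hxR.trans (lt_add_one R))]
    congr 1
    refine integral_congr_ae (Eventually.of_forall fun t => ?_)
    by_cases ht : t ∈ Metric.ball (0 : EuclideanSpace ℝ (Fin d)) (φ n).rOut
    · have h1 : ‖t‖ < 1 := (by simpa using ht : ‖t‖ < _).trans (hn.trans_le (min_le_right _ _))
      have h2 : ‖x - t‖ < R + 1 := (norm_sub_le x t).trans_lt (add_lt_add hxR h1)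
      simp only [indicator_of_mem (show x - t ∈ Metric.ball 0 (R + 1) by simpa using h2)]
    · rw [← (φ n).support_normed_eq (μ := volume)] at ht
      simp [hρ, Function.notMem_support.1 ht]
  calc eLpNorm (fun x => f x - τ x) 2 (volume.restrict K)
      = eLpNorm (fun x => F x - (ρ ⋆[ContinuousLinearMap.lsmul ℝ ℝ, volume] F) x) 2
          (volume.restrict K) :=
        eLpNorm_congr_ae ((ae_restrict_iff' hK.measurableSet).2 (Eventually.of_forall heq))
    _ ≤ ENNReal.ofReal (ε / 2) :=
        (eLpNorm_mono_measure _ Measure.restrict_le_self).trans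
          (hmol (φ n) (hn.trans_le (min_le_left _ _)))
    _ < ENNReal.ofReal ε := (ENNReal.ofReal_lt_ofReal_iff hε).2 (half_lt_self hε)

end Criterion

/-! ### Averages along orbits as stochastic test functions -/

section OrbitAverage

variable {d : ℕ} {Ω : Type*} {T : EuclideanSpace ℝ (Fin d) → Ω → Ω}

/-- The average of `v` along the orbits of the action, with weight `η`:
`ω ↦ ∫ v (T_t ω) η(-t) dt`, written as the value at `0` of a convolution. -/
noncomputable def orbitAverage {W : Type*} [NormedAddCommGroup W] [NormedSpace ℝ W]
    (T : EuclideanSpace ℝ (Fin d) → Ω → Ω) (v : Ω → ℝ) (η : EuclideanSpace ℝ (Fin d) → W)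
    (ω : Ω) : W :=
  ((fun t => v (T t ω)) ⋆[ContinuousLinearMap.lsmul ℝ ℝ, volume] η) 0

/-- Along an orbit, an orbit average is an honest convolution on `ℝ^d`; this is the source of its
regularity. -/
theorem orbitAverage_apply_action {W : Type*} [NormedAddCommGroup W] [NormedSpace ℝ W]
    (hT_add : ∀ x y ω, T (x + y) ω = T x (T y ω)) (v : Ω → ℝ)
    (η : EuclideanSpace ℝ (Fin d) → W) (ω : Ω) (y : EuclideanSpace ℝ (Fin d)) :
    orbitAverage T v η (T y ω)
      = ((fun t => v (T t ω)) ⋆[ContinuousLinearMap.lsmul ℝ ℝ, volume] η) y := by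
  rw [orbitAverage, convolution_def, convolution_def,
    
    ← integral_add_right_eq_self (fun t => ContinuousLinearMap.lsmul ℝ ℝ (v (T t ω)) (η (y - t))) y]
  simp [hT_add]

variable [MetricSpace Ω] [CompactSpace Ω] [MeasurableSpace Ω] [BorelSpace Ω]

/-- By dominated convergence: only the continuity of each map `T_t` is needed, not that of
`t ↦ T_t ω`. -/
theorem continuous_orbitAverage {W : Type*} [NormedAddCommGroup W] [NormedSpace ℝ W]
    (hT_meas : Measurable (fun p : EuclideanSpace ℝ (Fin d) × Ω => T p.1 p.2))
    (hT_cont : ∀ x, Continuous (T x)) {v : Ω → ℝ} (hv : Continuous v)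
    {η : EuclideanSpace ℝ (Fin d) → W} (hη : Continuous η) (hηc : HasCompactSupport η) :
    Continuous (orbitAverage T v η) := by
  obtain ⟨C, hC⟩ := isCompact_univ.exists_bound_of_continuousOn hv.continuousOn
  have hηneg : Continuous fun t : EuclideanSpace ℝ (Fin d) => η (0 - t) := by fun_prop
  have hηi : Integrable (fun t : EuclideanSpace ℝ (Fin d) => η (0 - t)) volume :=
    (hη.integrable_of_hasCompactSupport hηc).comp_sub_left 0
  refine continuous_of_dominated (bound := fun t => C * ‖η (0 - t)‖) (fun ω => ?_)
    (fun ω => Eventually.of_forall fun t => ?_) (hηi.norm.const_mul C)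
    (Eventually.of_forall fun t => ?_)
  · exact ((hv.measurable.comp (hT_meas.comp measurable_prodMk_right)).aestronglyMeasurable).smul
      hηneg.aestronglyMeasurable
  · simp only [ContinuousLinearMap.lsmul_apply, norm_smul]
    gcongr
    exact hC _ (mem_univ _)
  · simp only [ContinuousLinearMap.lsmul_apply]
    exact (hv.comp (hT_cont t)).smul continuous_const

theorem locallyIntegrable_orbit
    (hT_meas : Measurable (fun p : EuclideanSpace ℝ (Fin d) × Ω => T p.1 p.2))
    {v : Ω → ℝ} (hv : Continuous v) (ω : Ω) :
    LocallyIntegrable (fun t => v (T t ω)) volume := by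
  obtain ⟨C, hC⟩ := isCompact_univ.exists_bound_of_continuousOn hv.continuousOn
  exact (memLp_top_of_bound
    (hv.measurable.comp (hT_meas.comp measurable_prodMk_right)).aestronglyMeasurable C
    (Eventually.of_forall fun t => hC _ (mem_univ _))).locallyIntegrable le_top

theorem hasFDerivAt_orbitAverage (hT_add : ∀ x y ω, T (x + y) ω = T x (T y ω))
    (hT_meas : Measurable (fun p : EuclideanSpace ℝ (Fin d) × Ω => T p.1 p.2))
    {v : Ω → ℝ} (hv : Continuous v) {η : EuclideanSpace ℝ (Fin d) → ℝ}
    (hη : ContDiff ℝ 1 η) (hηc : HasCompactSupport η) (ω : Ω) :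
    HasFDerivAt (fun y => orbitAverage T v η (T y ω)) (orbitAverage T v (fderiv ℝ η) ω) 0 := by
  simp_rw [orbitAverage_apply_action hT_add]
  exact hηc.hasFDerivAt_convolution_right (ContinuousLinearMap.lsmul ℝ ℝ)
    (locallyIntegrable_orbit hT_meas hv ω) hη 0

theorem hasDerivAt_alongOrbit_orbitAverage (hT_add : ∀ x y ω, T (x + y) ω = T x (T y ω))
    (hT_meas : Measurable (fun p : EuclideanSpace ℝ (Fin d) × Ω => T p.1 p.2))
    {v : Ω → ℝ} (hv : Continuous v) {η : EuclideanSpace ℝ (Fin d) → ℝ}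
    (hη : ContDiff ℝ 1 η) (hηc : HasCompactSupport η) (i : Fin d) (ω : Ω) :
    HasDerivAt (alongOrbit T i (orbitAverage T v η) ω)
      (orbitAverage T v (fderiv ℝ η) ω (EuclideanSpace.single i (1 : ℝ))) 0 := by
  have h1 : HasDerivAt (fun δ : ℝ => δ • EuclideanSpace.single i (1 : ℝ))
      (EuclideanSpace.single i (1 : ℝ)) 0 := by
    simpa using (hasDerivAt_id (0 : ℝ)).smul_const (EuclideanSpace.single i (1 : ℝ))
  have h2 := hasFDerivAt_orbitAverage hT_add hT_meas hv hη hηc ω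
  exact HasFDerivAt.comp_hasDerivAt (f := fun δ : ℝ => δ • EuclideanSpace.single i (1 : ℝ)) 0
    (by simpa using h2) h1

theorem isStochC1_orbitAverage (hT_add : ∀ x y ω, T (x + y) ω = T x (T y ω))
    (hT_meas : Measurable (fun p : EuclideanSpace ℝ (Fin d) × Ω => T p.1 p.2))
    (hT_cont : ∀ x, Continuous (T x)) {v : Ω → ℝ} (hv : Continuous v)
    {η : EuclideanSpace ℝ (Fin d) → ℝ} (hη : ContDiff ℝ 1 η) (hηc : HasCompactSupport η) :
    IsStochC1 T (orbitAverage T v η) where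
  continuous := continuous_orbitAverage hT_meas hT_cont hv hη.continuous hηc
  differentiable i ω :=
    (hasDerivAt_alongOrbit_orbitAverage hT_add hT_meas hv hη hηc i ω).differentiableAt
  continuous_deriv i := by
    rw [show stochDeriv T i (orbitAverage T v η) = _ from
      funext fun ω => (hasDerivAt_alongOrbit_orbitAverage hT_add hT_meas hv hη hηc i ω).deriv]
    exact (continuous_orbitAverage hT_meas hT_cont hv (hη.continuous_fderiv one_ne_zero)
      (hηc.fderiv ℝ)).clm_apply continuous_const

theorem inner_stochGrad_orbitAverage (hT_add : ∀ x y ω, T (x + y) ω = T x (T y ω))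
    (hT_meas : Measurable (fun p : EuclideanSpace ℝ (Fin d) × Ω => T p.1 p.2))
    {v : Ω → ℝ} (hv : Continuous v) {η : EuclideanSpace ℝ (Fin d) → ℝ}
    (hη : ContDiff ℝ 1 η) (hηc : HasCompactSupport η) (ω : Ω) (w : EuclideanSpace ℝ (Fin d)) :
    inner ℝ (stochGrad T (orbitAverage T v η) ω) w = orbitAverage T v (fderiv ℝ η) ω w := by
  rw [← sum_smul_apply_single, PiLp.inner_apply]
  refine Finset.sum_congr rfl fun i _ => ?_
  have h : stochGrad T (orbitAverage T v η) ω i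
      = orbitAverage T v (fderiv ℝ η) ω (EuclideanSpace.single i (1 : ℝ)) :=
    (hasDerivAt_alongOrbit_orbitAverage hT_add hT_meas hv hη hηc i ω).deriv
  rw [h]
  simp

end OrbitAverage

/-! ### Realizations of solenoidal random fields -/

section WeakDivergence

variable {d : ℕ} {Ω : Type*} {T : EuclideanSpace ℝ (Fin d) → Ω → Ω}
  {σ : Ω → EuclideanSpace ℝ (Fin d)}

/-- Stationarity as invariance of a product measure: it allows replacing `T_x ω` by `ω` inside
integrals over `(x, ω)`. -/
theorem measurePreserving_skewProduct [MeasurableSpace Ω] {μ : Measure Ω} [SFinite μ]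
    (m : Measure (EuclideanSpace ℝ (Fin d)))
    [SFinite m] (hT_meas : Measurable (fun p : EuclideanSpace ℝ (Fin d) × Ω => T p.1 p.2))
    (hT_stat : ∀ x, MeasurePreserving (T x) μ μ) :
    MeasurePreserving (fun p : EuclideanSpace ℝ (Fin d) × Ω => (p.1, T p.1 p.2))
      (m.prod μ) (m.prod μ) :=
  (MeasurePreserving.id m).skew_product hT_meas (Eventually.of_forall fun x => (hT_stat x).map_eq)

/-- A function orthogonal to all continuous functions vanishes almost everywhere. -/
theorem ae_eq_zero_of_forall_integral_continuous_mul_eq_zero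
    [MetricSpace Ω] [MeasurableSpace Ω] [BorelSpace Ω] {μ : Measure Ω} [IsFiniteMeasure μ]
    {g : Ω → ℝ}
    (hg : Integrable g μ) (h : ∀ v : Ω → ℝ, Continuous v → ∫ ω, v ω * g ω ∂μ = 0) :
    g =ᵐ[μ] 0 := by
  refine ae_eq_zero_of_forall_setIntegral_isClosed_eq_zero hg fun s hs => ?_
  have hδ : ∀ n : ℕ, (0 : ℝ) < 1 / ((n : ℝ) + 1) := fun n => by positivity
  have hlim : Tendsto (fun n : ℕ => ∫ ω, (thickenedIndicator (hδ n) s ω : ℝ) * g ω ∂μ) atTop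
      (𝓝 (∫ ω, s.indicator g ω ∂μ)) := by
    refine tendsto_integral_of_dominated_convergence (fun ω => ‖g ω‖) (fun n => ?_) hg.norm
      (fun n => Eventually.of_forall fun ω => ?_) (Eventually.of_forall fun ω => ?_)
    · exact (NNReal.continuous_coe.comp
        (thickenedIndicator (hδ n) s).continuous).aestronglyMeasurable.mul hg.aestronglyMeasurable
    · have h1 : (thickenedIndicator (hδ n) s ω : ℝ) ≤ 1 := by
        exact_mod_cast thickenedIndicator_le_one (hδ n) s ω
      rw [norm_mul, Real.norm_of_nonneg NNReal.zero_le_coe]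
      exact mul_le_of_le_one_left (norm_nonneg _) h1
    · have h1 := (tendsto_pi_nhds.1 (thickenedIndicator_tendsto_indicator_closure hδ
        tendsto_one_div_add_atTop_nhds_zero_nat s)) ω
      rw [hs.closure_eq] at h1
      have h2 := ((NNReal.continuous_coe.tendsto _).comp h1).mul_const (g ω)
      refine h2.congr' (Eventually.of_forall fun n => rfl) |>.trans (le_of_eq ?_)
      by_cases hω : ω ∈ s <;> simp [hω]
  rw [← integral_indicator hs.measurableSet]
  refine tendsto_nhds_unique hlim ?_
  exact tendsto_const_nhds.congr fun n =>
    (h _ (NNReal.continuous_coe.comp (thickenedIndicator (hδ n) s).continuous)).symm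

theorem continuous_stochGrad [TopologicalSpace Ω] {u : Ω → ℝ} (hu : IsStochC1 T u) :
    Continuous (stochGrad T u) :=
  (PiLp.continuous_toLp 2 _).comp (continuous_pi hu.continuous_deriv)

variable [MetricSpace Ω] [CompactSpace Ω] [MeasurableSpace Ω] [BorelSpace Ω] {μ : Measure Ω}

theorem integral_inner_stochGrad_eq_zero [IsFiniteMeasure μ] (hσ : MemLp σ 2 μ)
    (hσ_sol : hσ.toLp σ ∈ L2sol μ T) {u : Ω → ℝ} (hu : IsStochC1 T u) :
    ∫ ω, inner ℝ (stochGrad T u ω) (σ ω) ∂μ = 0 := by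
  have hmem : MemLp (stochGrad T u) 2 μ :=
    (continuous_stochGrad hu).memLp_of_hasCompactSupport (HasCompactSupport.of_compactSpace _)
  have hpot : hmem.toLp _ ∈ L2pot μ T :=
    Submodule.le_topologicalClosure _ (Submodule.subset_span ⟨u, hu, hmem.coeFn_toLp⟩)
  have h := (Submodule.mem_orthogonal _ _).1 hσ_sol _ hpot
  rw [L2.inner_def] at h
  rw [← h]
  refine integral_congr_ae ?_
  filter_upwards [hmem.coeFn_toLp, hσ.coeFn_toLp] with ω h1 h2
  rw [h1, h2]

variable [IsProbabilityMeasure μ]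

theorem ae_memL2Loc_realization
    (hT_meas : Measurable (fun p : EuclideanSpace ℝ (Fin d) × Ω => T p.1 p.2))
    (hT_stat : ∀ x, MeasurePreserving (T x) μ μ) (hσ : MemLp σ 2 μ) :
    ∀ᵐ ω ∂μ, MemL2Loc (fun x => σ (T x ω)) := by
  have h : ∀ n : ℕ, ∀ᵐ ω ∂μ, MemLp (fun x => σ (T x ω)) 2
      (volume.restrict (Metric.closedBall 0 (n : ℝ))) := by
    intro n
    set m := (volume : Measure (EuclideanSpace ℝ (Fin d))).restrict (Metric.closedBall 0 (n : ℝ))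
    have hm : IsFiniteMeasure m :=
      isFiniteMeasure_restrict.2 measure_closedBall_lt_top.ne
    have h1 : MemLp (fun p : EuclideanSpace ℝ (Fin d) × Ω => σ (T p.1 p.2)) 2 (m.prod μ) :=
      (hσ.comp_snd m).comp_measurePreserving (measurePreserving_skewProduct m hT_meas hT_stat)
    filter_upwards [((memLp_two_iff_integrable_sq_norm h1.1).1 h1).prod_left_ae,
      h1.1.prod_swap.prodMk_left] with ω hω1 hω2
    exact (memLp_two_iff_integrable_sq_norm hω2).2 hω1
  filter_upwards [ae_all_iff.2 h] with ω hω K hK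
  obtain ⟨R, hR⟩ := hK.isBounded.subset_closedBall (0 : EuclideanSpace ℝ (Fin d))
  obtain ⟨n, hn⟩ := exists_nat_ge R
  exact (hω n).mono_measure
    (Measure.restrict_mono (hR.trans (Metric.closedBall_subset_closedBall hn)) le_rfl)

/-- Almost every realization of a solenoidal random field is weakly divergence free against a
given test function `η`. By stationarity, pairing `ω ↦ ∫ Dη(t) σ(T_t ω) dt` with a continuous `v`
amounts to pairing `σ` with the stochastic gradient of the orbit average of `v`. -/
theorem ae_integral_fderiv_apply_realization_eq_zero (hT_zero : ∀ ω, T 0 ω = ω)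
    (hT_add : ∀ x y ω, T (x + y) ω = T x (T y ω))
    (hT_meas : Measurable (fun p : EuclideanSpace ℝ (Fin d) × Ω => T p.1 p.2))
    (hT_cont : ∀ x, Continuous (T x)) (hT_stat : ∀ x, MeasurePreserving (T x) μ μ)
    (hσ : MemLp σ 2 μ) (hσ_sol : hσ.toLp σ ∈ L2sol μ T)
    {η : EuclideanSpace ℝ (Fin d) → ℝ} (hη : ContDiff ℝ 1 η) (hηc : HasCompactSupport η) :
    ∀ᵐ ω ∂μ, ∫ t, fderiv ℝ η t (σ (T t ω)) = 0 := by
  have hskew := measurePreserving_skewProduct (μ := μ) volume hT_meas hT_stat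
  have hDc : Continuous (fderiv ℝ η) := hη.continuous_fderiv one_ne_zero
  have hDi : Integrable (fderiv ℝ η) volume := hDc.integrable_of_hasCompactSupport (hηc.fderiv ℝ)
  have hσi : Integrable σ μ := hσ.integrable (by norm_num)
  have hpair : Integrable (fun p : EuclideanSpace ℝ (Fin d) × Ω => fderiv ℝ η p.1 (σ p.2))
      (volume.prod μ) := by
    refine (hDi.norm.mul_prod hσi.norm).mono' ?_ (Eventually.of_forall fun p =>
      (fderiv ℝ η p.1).le_opNorm (σ p.2))
    exact (ContinuousLinearMap.id ℝ _).aestronglyMeasurable_comp₂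
      hDi.aestronglyMeasurable.comp_fst hσi.aestronglyMeasurable.comp_snd
  have hreal : Integrable (fun p : EuclideanSpace ℝ (Fin d) × Ω => fderiv ℝ η p.1 (σ (T p.1 p.2)))
      (volume.prod μ) := hskew.integrable_comp_of_integrable hpair
  refine ae_eq_zero_of_forall_integral_continuous_mul_eq_zero hreal.integral_prod_right
    fun v hv => ?_
  obtain ⟨C, hC⟩ := isCompact_univ.exists_bound_of_continuousOn hv.continuousOn
  have hvreal : Integrable (fun p : EuclideanSpace ℝ (Fin d) × Ω =>
      v p.2 * fderiv ℝ η p.1 (σ (T p.1 p.2))) (volume.prod μ) :=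
    hreal.bdd_mul (hv.measurable.comp measurable_snd).aestronglyMeasurable
      (Eventually.of_forall fun p => hC _ (mem_univ _))
  have hTneg : Measurable fun p : EuclideanSpace ℝ (Fin d) × Ω => T (-p.1) p.2 :=
    hT_meas.comp (measurable_fst.neg.prodMk measurable_snd)
  have hvpair : Integrable (fun p : EuclideanSpace ℝ (Fin d) × Ω =>
      v (T (-p.1) p.2) * fderiv ℝ η p.1 (σ p.2)) (volume.prod μ) :=
    hpair.bdd_mul (hv.measurable.comp hTneg).aestronglyMeasurable
      (Eventually.of_forall fun p => hC _ (mem_univ _))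
  have havg : ∀ ω, ∫ t, v (T (-t) ω) * fderiv ℝ η t (σ ω)
      = inner ℝ (stochGrad T (orbitAverage T v η) ω) (σ ω) := by
    intro ω
    have hint : Integrable (fun t => v (T (-t) ω) • fderiv ℝ η t) volume :=
      hDi.bdd_smul _ (hv.measurable.comp
        (hTneg.comp measurable_prodMk_right)).aestronglyMeasurable
        (Eventually.of_forall fun t => hC _ (mem_univ _))
    have happly := ContinuousLinearMap.integral_apply hint (σ ω)
    rw [← integral_neg_eq_self] at happly
    rw [inner_stochGrad_orbitAverage hT_add hT_meas hv hη hηc]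
    simpa [orbitAverage, convolution_def] using happly.symm
  calc ∫ ω, v ω * (∫ t, fderiv ℝ η t (σ (T t ω))) ∂μ
      = ∫ ω, (∫ t, v ω * fderiv ℝ η t (σ (T t ω))) ∂μ := by simp_rw [integral_const_mul]
    _ = ∫ p, v p.2 * fderiv ℝ η p.1 (σ (T p.1 p.2)) ∂(volume.prod μ) :=
        (integral_prod_symm _ hvreal).symm
    _ = ∫ p, v (T (-p.1) p.2) * fderiv ℝ η p.1 (σ p.2) ∂(volume.prod μ) := by
        -- Change variables by `(t, ω) ↦ (t, T_t ω)`, using `T_{-t} (T_t ω) = ω`.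
        conv_rhs => rw [← hskew.map_eq]
        rw [integral_map hskew.measurable.aemeasurable
          (by rw [hskew.map_eq]; exact hvpair.aestronglyMeasurable)]
        simp [← hT_add, hT_zero]
    _ = ∫ ω, (∫ t, v (T (-t) ω) * fderiv ℝ η t (σ ω)) ∂μ := integral_prod_symm _ hvpair
    _ = 0 := by
        simp_rw [havg]
        exact integral_inner_stochGrad_eq_zero hσ hσ_sol
          (isStochC1_orbitAverage hT_add hT_meas hT_cont hv hη hηc)

end WeakDivergence

theorem mainTheorem9 {d : ℕ} (hd : 2 ≤ d)
    {Ω : Type*} [MetricSpace Ω] [CompactSpace Ω] [MeasurableSpace Ω] [BorelSpace Ω]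
    (μ : Measure Ω) [IsProbabilityMeasure μ]
    (T : EuclideanSpace ℝ (Fin d) → Ω → Ω)
    (hT_zero : ∀ ω, T 0 ω = ω)
    (hT_add : ∀ x y ω, T (x + y) ω = T x (T y ω))
    (hT_meas : Measurable (fun p : EuclideanSpace ℝ (Fin d) × Ω => T p.1 p.2))
    (hT_cont : ∀ x, Continuous (T x))
    (hT_stat : ∀ x, MeasurePreserving (T x) μ μ)
    (σ : Ω → EuclideanSpace ℝ (Fin d)) (hσ : MemLp σ 2 μ)
    (hσ_sol : hσ.toLp σ ∈ L2sol μ T) :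
    ∀ᵐ ω ∂μ, MemL2SolLoc (fun x => σ (T x ω)) := by
  let φ : ℕ → ContDiffBump (0 : EuclideanSpace ℝ (Fin d)) := fun n =>
    ⟨1 / ((n : ℝ) + 1) / 2, 1 / ((n : ℝ) + 1), by positivity, half_lt_self (by positivity)⟩
  have hφ : Tendsto (fun n => (φ n).rOut) atTop (𝓝 0) := tendsto_one_div_add_atTop_nhds_zero_nat
  have hs : ∀ n, ContDiff ℝ ((⊤ : ℕ∞) : WithTop ℕ∞) ((φ n).normed volume) :=
    fun n => (φ n).contDiff_normed
  have hc : ∀ n, HasCompactSupport ((φ n).normed volume) := fun n =>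
    (φ n).hasCompactSupport_normed
  -- Testing against countably many translates of countably many mollifiers keeps the
  -- exceptional set of `ω` null.
  have hweak : ∀ n k : ℕ, ∀ᵐ ω ∂μ,
      ∫ t, fderiv ℝ ((φ n).normed volume) (TopologicalSpace.denseSeq _ k - t) (σ (T t ω)) = 0 := by
    intro n k
    set x := TopologicalSpace.denseSeq (EuclideanSpace ℝ (Fin d)) k
    have hsx : ContDiff ℝ 1 fun t => (φ n).normed volume (x - t) :=
      ((hs n).of_le (by simp)).comp (contDiff_const.sub contDiff_id)
    have hcx : HasCompactSupport fun t => (φ n).normed volume (x - t) :=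
      (hc n).comp_homeomorph (Homeomorph.subLeft x)
    filter_upwards [ae_integral_fderiv_apply_realization_eq_zero hT_zero hT_add hT_meas hT_cont
      hT_stat hσ hσ_sol hsx hcx] with ω hω
    have hD : ∀ t, fderiv ℝ (fun t => (φ n).normed volume (x - t)) t
        = -fderiv ℝ ((φ n).normed volume) (x - t) := fun t => by
      have h1 := ((hs n).differentiable (by simp) (x - t)).hasFDerivAt.comp t
        ((hasFDerivAt_id t).const_sub x)
      exact h1.fderiv.trans (by simp)
    simpa [hD, integral_neg] using hω
  filter_upwards [ae_memL2Loc_realization hT_meas hT_stat hσ,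
    ae_all_iff.2 fun n => ae_all_iff.2 (hweak n)] with ω hloc hω
  refine memL2SolLoc_of_forall_integral_fderiv_eq_zero hd hloc hφ fun n => ?_
  -- The left-hand side is the divergence of a smooth field, hence continuous in `x`, and it
  -- vanishes on a dense sequence.
  have hcont : Continuous fun x =>
      ∫ t, fderiv ℝ ((φ n).normed volume) (x - t) (σ (T t ω)) := by
    simp_rw [← divField_convolution (hs n) (hc n) hloc.locallyIntegrable,
      divField_eq_euclideanTrace]
    have h : ContDiff ℝ ((⊤ : ℕ∞) : WithTop ℕ∞) _ := (hc n).contDiff_convolution_left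
      (ContinuousLinearMap.lsmul ℝ ℝ) (hs n) hloc.locallyIntegrable
    exact (euclideanTrace d).continuous.comp (h.continuous_fderiv (by simp))
  exact congrFun ((TopologicalSpace.denseRange_denseSeq _).equalizer hcont continuous_const
    (funext fun k => hω n k))
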